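/- **Setting.** Let $\overline{\mathcal B}_*$ be the set of (isomorphism classes of) rooted, connected, locally finite directed acyclic graphs whose vertices carry marks in $\{0,1,2,\dots\}$, and let $\mathcal B_*\subseteq\overline{\mathcal B}_*$ be the finite ones. Put $d_*(G,H)=1/(1+s)$, where $s\in\{0,1,\dots,\infty\}$ is the supremum of the radii at which the balls around the roots of $G$ and $H$ (for the undirected hop distance) are isomorphic as rooted marked directed graphs, and $1/(1+\infty)=0$. A leaf is a vertex of in-degree zero. A construction function $f$ assigns to each finite graph $G\in\mathcal B_*$ and each $u\in[0,1]$ a nonempty set $f(G,u)$ of vertices of $G$. For $1\le k<\infty$, $f_k$ is a construction function such that for $u$ uniform on $[0,1]$ the set $f_k(G,u)$ is a uniformly random set of $\min(k,L(G))$ leaves of $G$, where $L(G)$ is the number of leaves; $f_\infty(G,u)$ is the set of all leaves of $G$. Let $\xi_1,\xi_2,\dots$ be i.i.d. delays with values in $\{1,2,\dots\}$ almost surely and $\mathbb E\,\xi_1<\infty$, and let $\theta_1,\theta_2,\dots$ be i.i.d. uniform on $[0,1]$, independent of the delays. Let $G_0$ be a single root marked $0$. For $t\ge1$ the graph $G_t=G_t(f)$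 is obtained from $G_{t-1}$ by adding a vertex $t$, marked $t$, with an edge from $t$ to each vertex of $f(G_{\max(t-\xi_t,0)},\theta_t)$. Let $G_\infty(f):=\lim_{t\to\infty}G_t(f)$, the limit being taken with respect to $d_*$. For $k\in\{1,2,\dots,\infty\}$ let $G_t(f_k)$ be built from driving sequences $\xi^{(k)},\theta^{(k)}$ as above, where the law of the delays does not depend on $k$. **Theorem.** Almost surely the limits $G_\infty(f_k)$, $1\le k<\infty$, and $G_\infty(f_\infty)$ exist in $(\overline{\mathcal B}_*,d_*)$, and the diagram $$\begin{array}{ccc} G_t(f_k) & \xrightarrow{\;k\to\infty\;} & G_t(f_\infty)\\ {\scriptstyle t\to\infty}\big\downarrow & & \big\downarrow{\scriptstyle t\to\infty}\\ G_\infty(f_k) & \xrightarrow{\;k\to\infty\;} & G_\infty(f_\infty)\end{array}$$ commutes in the sense that all four convergences hold in distribution in $(\overline{\mathcal B}_*,d_*)$: $G_t(f_k)\to G_t(f_\infty)$ as $k\to\infty$ for every $t\ge0$; $G_t(f_k)\to G_\infty(f_k)$ as $t\to\infty$ for every $1\le k<\infty$; $G_t(f_\infty)\to G_\infty(f_\infty)$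 as $t\to\infty$; and $G_\infty(f_k)\to G_\infty(f_\infty)$ as $k\to\infty$. If moreover $\mathbb E\,\xi_1^{1+\delta}<\infty$ for some $\delta>0$ and the delays are coupled, that is, all the graphs live on one probability space and $\xi^{(k)}=\xi^{(\infty)}$ almost surely for every $k$, then all four convergences hold almost surely. -/

import Mathlib

open Filter MeasureTheory ProbabilityTheory
open scoped Topology ENNReal unitInterval

noncomputable section

/-- A rooted, connected, locally finite directed acyclic graph whose vertices carry marks in `ℕ`.
Such a graph is countable, so its vertices are taken to be natural numbers; the names of the
vertices are immaterial, because two graphs are compared below only up to isomorphism.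
`Adj u v` is the directed edge `u → v`; values of `mark` outside `verts` are irrelevant. -/
structure MarkedDAG where
  verts : Set ℕ
  Adj : ℕ → ℕ → Prop
  root : ℕ
  mark : ℕ → ℕ
  adj_mem : ∀ u v, Adj u v → u ∈ verts ∧ v ∈ verts
  root_mem : root ∈ verts
  acyclic : ∀ v, ¬ Relation.TransGen Adj v v
  connected : ∀ v ∈ verts, (SimpleGraph.fromRel Adj).Reachable root v
  locallyFinite : ∀ v, {w | Adj v w ∨ Adj w v}.Finite

namespace MarkedDAG

/-- The underlying undirected graph, which defines the hop distance. -/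
def skeleton (G : MarkedDAG) : SimpleGraph ℕ := SimpleGraph.fromRel G.Adj

/-- The ball of radius `s` around the root for the hop distance. -/
def ball (G : MarkedDAG) (s : ℕ) : Set ℕ := {v | G.skeleton.edist G.root v ≤ s}

/-- The balls of radius `s` around the roots agree: they are isomorphic as rooted, marked,
directed graphs. -/
def BallsAgree (s : ℕ) (G H : MarkedDAG) : Prop :=
  ∃ φ : ℕ → ℕ, Set.BijOn φ (G.ball s) (H.ball s) ∧ φ G.root = H.root ∧
    (∀ u ∈ G.ball s, ∀ v ∈ G.ball s, G.Adj u v ↔ H.Adj (φ u) (φ v)) ∧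
    ∀ v ∈ G.ball s, G.mark v = H.mark (φ v)

/-- The supremum, possibly infinite, of the radii at which the balls around the roots agree. -/
def agreeRadius (G H : MarkedDAG) : ℕ∞ := ⨆ (s : ℕ) (_ : BallsAgree s G H), (s : ℕ∞)

/-- The local distance `1 / (1 + s)`, with `s` the supremum of the radii of agreement
(and the value `0` if `s = ∞`). -/
def dStar (G H : MarkedDAG) : ℝ := ((1 + (agreeRadius G H : ℝ≥0∞))⁻¹).toReal

theorem mem_ball (G : MarkedDAG) (s v : ℕ) :
    v ∈ G.ball s ↔ G.skeleton.edist G.root v ≤ s := Iff.rfl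

theorem root_mem_ball (G : MarkedDAG) (s : ℕ) : G.root ∈ G.ball s := by
  simp [ball]

theorem mem_ball_succ (G : MarkedDAG) (s : ℕ) (v : ℕ) :
    v ∈ G.ball (s + 1) ↔ v ∈ G.ball s ∨ ∃ u ∈ G.ball s, G.skeleton.Adj u v := by
  constructor
  · intro h
    have hne : G.skeleton.edist G.root v ≠ ⊤ := by
      intro h'
      rw [mem_ball, h', top_le_iff] at h
      exact ENat.natCast_ne_top _ h
    obtain ⟨p, hp⟩ := SimpleGraph.exists_walk_of_edist_ne_top hne
    have hlen : p.length ≤ s + 1 := by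
      have : (p.length : ℕ∞) ≤ ((s + 1 : ℕ) : ℕ∞) := by rw [hp]; exact h
      exact_mod_cast this
    rcases Nat.lt_or_ge s p.length with hs | hs
    · right
      have hnil : ¬ p.Nil := by
        intro hn
        rw [← SimpleGraph.Walk.length_eq_zero_iff] at hn
        omega
      refine ⟨p.penultimate, ?_, p.adj_penultimate hnil⟩
      refine (SimpleGraph.edist_le p.dropLast).trans ?_
      have h1 := p.length_dropLast_add_one hnil
      have : p.dropLast.length ≤ s := by omega
      exact_mod_cast this
    · left
      refine (SimpleGraph.edist_le p).trans ?_
      exact_mod_cast hs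
  · rintro (h | ⟨u, hu, huv⟩)
    · rw [mem_ball] at h ⊢
      refine h.trans ?_
      exact_mod_cast Nat.le_succ s
    · refine (SimpleGraph.edist_triangle (v := u)).trans ?_
      have h1 : G.skeleton.edist u v = 1 := SimpleGraph.edist_eq_one_iff_adj.2 huv
      rw [h1]
      push_cast
      exact add_le_add_left hu 1

theorem ball_mono (G : MarkedDAG) {s t : ℕ} (h : s ≤ t) : G.ball s ⊆ G.ball t := by
  intro v hv
  rw [mem_ball] at hv ⊢
  refine hv.trans ?_
  exact_mod_cast h

theorem adj_ne (G : MarkedDAG) {u v : ℕ} (h : G.Adj u v) : u ≠ v := by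
  rintro rfl
  exact G.acyclic u (Relation.TransGen.single h)

theorem skeleton_adj (G : MarkedDAG) {u v : ℕ} :
    G.skeleton.Adj u v ↔ G.Adj u v ∨ G.Adj v u := by
  simp only [skeleton, SimpleGraph.fromRel_adj]
  constructor
  · exact fun h => h.2
  · intro h
    refine ⟨?_, h⟩
    rcases h with h | h
    · exact G.adj_ne h
    · exact (G.adj_ne h).symm

theorem BallsAgree.refl (s : ℕ) (G : MarkedDAG) : BallsAgree s G G :=
  ⟨id, Set.bijOn_id _, rfl, fun _ _ _ _ => Iff.rfl, fun _ _ => rfl⟩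

theorem BallsAgree.symm {s : ℕ} {G H : MarkedDAG} (h : BallsAgree s G H) :
    BallsAgree s H G := by
  obtain ⟨φ, hb, hr, ha, hm⟩ := h
  have hinv := hb.invOn_invFunOn
  have hb' : Set.BijOn (Function.invFunOn φ (G.ball s)) (H.ball s) (G.ball s) :=
    hinv.symm.bijOn hb.surjOn.mapsTo_invFunOn hb.mapsTo
  refine ⟨Function.invFunOn φ (G.ball s), hb', ?_, ?_, ?_⟩
  · rw [← hr]
    exact hinv.1 (G.root_mem_ball s)
  · intro u hu v hv
    rw [ha _ (hb'.mapsTo hu) _ (hb'.mapsTo hv), hinv.2 hu, hinv.2 hv]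
  · intro v hv
    rw [hm _ (hb'.mapsTo hv), hinv.2 hv]

theorem BallsAgree.trans {s : ℕ} {G H K : MarkedDAG} (h : BallsAgree s G H)
    (h' : BallsAgree s H K) : BallsAgree s G K := by
  obtain ⟨φ, hb, hr, ha, hm⟩ := h
  obtain ⟨ψ, hb', hr', ha', hm'⟩ := h'
  refine ⟨ψ ∘ φ, hb'.comp hb, by simp [hr, hr'], ?_, ?_⟩
  · intro u hu v hv
    rw [ha u hu v hv, ha' _ (hb.mapsTo hu) _ (hb.mapsTo hv)]
    rfl
  · intro v hv
    rw [hm v hv, hm' _ (hb.mapsTo hv)]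
    rfl

theorem mapsTo_ball {s : ℕ} {G H : MarkedDAG} {φ : ℕ → ℕ} (hr : φ G.root = H.root)
    (ha : ∀ u ∈ G.ball s, ∀ v ∈ G.ball s, G.Adj u v ↔ H.Adj (φ u) (φ v)) :
    ∀ t ≤ s, Set.MapsTo φ (G.ball t) (H.ball t) := by
  intro t
  induction t with
  | zero =>
    intro _ v hv
    have : v = G.root := by simpa [ball] using hv
    rw [this, hr]
    exact H.root_mem_ball 0
  | succ t ih =>
    intro ht v hv
    have hvs := G.ball_mono ht hv
    rw [mem_ball_succ] at hv ⊢
    rcases hv with hv | ⟨u, hu, huv⟩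
    · exact Or.inl (ih (by omega) hv)
    · have hus := G.ball_mono (by omega : t ≤ s) hu
      refine Or.inr ⟨φ u, ih (by omega) hu, ?_⟩
      rw [skeleton_adj] at huv ⊢
      rwa [← ha u hus v hvs, ← ha v hvs u hus]

theorem BallsAgree.mono {s t : ℕ} (hts : t ≤ s) {G H : MarkedDAG} (h : BallsAgree s G H) :
    BallsAgree t G H := by
  obtain ⟨φ, hb, hr, ha, hm⟩ := h
  have hsub := G.ball_mono hts
  refine ⟨φ, ⟨mapsTo_ball hr ha t hts, hb.injOn.mono hsub, ?_⟩, hr,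
    fun u hu v hv => ha u (hsub hu) v (hsub hv), fun v hv => hm v (hsub hv)⟩
  have hinv := hb.invOn_invFunOn
  have hb' : Set.MapsTo (Function.invFunOn φ (G.ball s)) (H.ball s) (G.ball s) :=
    hb.surjOn.mapsTo_invFunOn
  have hmap := mapsTo_ball (s := s) (G := H) (H := G) (φ := Function.invFunOn φ (G.ball s))
    (by rw [← hr]; exact hinv.1 (G.root_mem_ball s))
    (fun u hu v hv => by rw [ha _ (hb' hu) _ (hb' hv), hinv.2 hu, hinv.2 hv]) t hts
  intro v hv
  exact ⟨_, hmap hv, hinv.2 (H.ball_mono hts hv)⟩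

theorem agreeRadius_self (G : MarkedDAG) : agreeRadius G G = ⊤ := by
  refine ENat.eq_top_iff_forall_ge.2 fun n => ?_
  exact le_iSup₂_of_le n (BallsAgree.refl n G) le_rfl

theorem agreeRadius_comm (G H : MarkedDAG) : agreeRadius G H = agreeRadius H G :=
  le_antisymm (iSup₂_le fun s h => le_iSup₂_of_le s h.symm le_rfl)
    (iSup₂_le fun s h => le_iSup₂_of_le s h.symm le_rfl)

theorem min_agreeRadius_le (G H K : MarkedDAG) :
    min (agreeRadius G H) (agreeRadius H K) ≤ agreeRadius G K := by
  refine le_of_forall_lt fun c hc => ?_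
  obtain ⟨h1, h2⟩ := lt_min_iff.1 hc
  simp only [agreeRadius, lt_iSup_iff] at h1 h2
  obtain ⟨s, hs, hcs⟩ := h1
  obtain ⟨t, ht, hct⟩ := h2
  have hst : c < ((min s t : ℕ) : ℕ∞) := by
    exact lt_min hcs hct
  exact lt_of_lt_of_le hst (le_iSup₂_of_le (min s t)
    ((hs.mono (min_le_left s t)).trans (ht.mono (min_le_right s t))) le_rfl)

theorem dStar_triangle (G H K : MarkedDAG) : dStar G K ≤ dStar G H + dStar H K := by
  have hfin : ∀ a : ℕ∞, (1 + (a : ℝ≥0∞))⁻¹ ≠ ⊤ := fun a => by simp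
  have hanti : ∀ a b : ℕ∞, a ≤ b →
      ((1 + (b : ℝ≥0∞))⁻¹).toReal ≤ ((1 + (a : ℝ≥0∞))⁻¹).toReal := by
    intro a b hab
    refine ENNReal.toReal_mono (hfin a) (ENNReal.inv_le_inv.2 ?_)
    exact add_le_add_right (ENat.toENNReal_le.2 hab) 1
  have h := min_agreeRadius_le G H K
  rcases min_le_iff.1 h with h | h
  · exact (hanti _ _ h).trans (le_add_of_nonneg_right ENNReal.toReal_nonneg)
  · exact (hanti _ _ h).trans (le_add_of_nonneg_left ENNReal.toReal_nonneg)

/-- The distance `dStar`. Passing to isomorphism classes turns it into a metric; working with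
representatives changes neither convergence nor weak convergence of laws. -/
instance : PseudoMetricSpace MarkedDAG where
  dist := dStar
  dist_self G := by simp [dStar, agreeRadius_self]
  dist_comm G H := by simp [dStar, agreeRadius_comm G H]
  dist_triangle := dStar_triangle

instance : MeasurableSpace MarkedDAG := borel MarkedDAG

instance : BorelSpace MarkedDAG := ⟨rfl⟩

end MarkedDAG

/-- Finite rooted connected marked DAGs. -/
structure FiniteDAG extends MarkedDAG where
  finite : verts.Finite

namespace FiniteDAG

open Classical in
/-- The leaves: the vertices of in-degree zero. -/
def leaves (G : FiniteDAG) : Finset ℕ := G.finite.toFinset.filter fun v => ∀ w, ¬ G.Adj w v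

theorem leaves_subset (G : FiniteDAG) : (G.leaves : Set ℕ) ⊆ G.verts := by
  intro v hv
  simp only [leaves, Finset.mem_coe, Finset.mem_filter, Set.Finite.mem_toFinset] at hv
  exact hv.1

theorem leaves_nonempty (G : FiniteDAG) : G.leaves.Nonempty := by
  by_contra hne
  have hstep : ∀ v ∈ G.verts, ∃ w, G.Adj w v := by
    intro v hv
    by_contra hw
    push Not at hw
    exact hne ⟨v, by simp [leaves, hv, hw]⟩
  have : IsStrictOrder ℕ (Relation.TransGen G.Adj) :=
    { irrefl := G.acyclic, trans := fun _ _ _ => Relation.TransGen.trans }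
  have hwf := G.finite.wellFoundedOn (r := Relation.TransGen G.Adj)
  obtain ⟨m, -, hmin⟩ := hwf.has_min Set.univ ⟨⟨G.root, G.root_mem⟩, trivial⟩
  obtain ⟨w, hw⟩ := hstep m m.2
  exact hmin ⟨w, (G.adj_mem _ _ hw).1⟩ trivial (Relation.TransGen.single hw)

/-- The graph consisting of the root alone, marked `0`. -/
def single : FiniteDAG where
  verts := {0}
  Adj _ _ := False
  root := 0
  mark _ := 0
  adj_mem _ _ h := h.elim
  root_mem := rfl
  acyclic v h := by
    obtain ⟨_, h, _⟩ := Relation.TransGen.head'_iff.1 h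
    exact h
  connected v hv := by
    rw [Set.mem_singleton_iff.1 hv]
  locallyFinite v := by simp
  finite := Set.finite_singleton 0

/-- Add to `G` a new vertex `n`, marked `n`, with an edge to each vertex of `S`. -/
def attach (G : FiniteDAG) (n : ℕ) (hn : n ∉ G.verts) (S : Finset ℕ) (hS : S.Nonempty)
    (hSG : (S : Set ℕ) ⊆ G.verts) : FiniteDAG where
  verts := insert n G.verts
  Adj u v := G.Adj u v ∨ (u = n ∧ v ∈ S)
  root := G.root
  mark := Function.update G.mark n n
  adj_mem u v h := by
    rcases h with h | ⟨rfl, h⟩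
    · exact ⟨Or.inr (G.adj_mem u v h).1, Or.inr (G.adj_mem u v h).2⟩
    · exact ⟨Or.inl rfl, Or.inr (hSG h)⟩
  root_mem := Or.inr G.root_mem
  acyclic := by
    have key : ∀ u v, Relation.TransGen (fun u v => G.Adj u v ∨ (u = n ∧ v ∈ S)) u v →
        v ∈ G.verts ∧ (u ≠ n → Relation.TransGen G.Adj u v) := by
      intro u v h
      induction h with
      | single h =>
        rcases h with h | ⟨rfl, h⟩
        · exact ⟨(G.adj_mem _ _ h).2, fun _ => .single h⟩
        · exact ⟨hSG h, fun h' => (h' rfl).elim⟩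
      | tail _ h ih =>
        rcases h with h | ⟨rfl, h⟩
        · exact ⟨(G.adj_mem _ _ h).2, fun hu => (ih.2 hu).tail h⟩
        · exact (hn ih.1).elim
    intro v h
    obtain ⟨h1, h2⟩ := key v v h
    exact G.acyclic v (h2 fun hv => hn (hv ▸ h1))
  connected := by
    have hle : SimpleGraph.fromRel G.Adj ≤
        SimpleGraph.fromRel (fun u v => G.Adj u v ∨ (u = n ∧ v ∈ S)) := by
      intro u v h
      simp only [SimpleGraph.fromRel_adj] at h ⊢
      exact ⟨h.1, h.2.imp Or.inl Or.inl⟩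
    rintro v (rfl | hv)
    · obtain ⟨w, hw⟩ := hS
      refine ((G.connected w (hSG hw)).mono hle).trans (SimpleGraph.Adj.reachable ?_)
      rw [SimpleGraph.fromRel_adj]
      exact ⟨fun h => hn (h ▸ hSG hw), Or.inr (Or.inr ⟨rfl, hw⟩)⟩
    · exact (G.connected v hv).mono hle
  locallyFinite v := by
    refine (G.finite.insert n).subset ?_
    rintro w ((h | ⟨rfl, h⟩) | (h | ⟨rfl, h⟩))
    · exact Or.inr (G.adj_mem _ _ h).2
    · exact Or.inr (hSG h)
    · exact Or.inr (G.adj_mem _ _ h).1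
    · exact Or.inl rfl
  finite := G.finite.insert n

end FiniteDAG

/-- A construction function: `choose G u` is the nonempty set of vertices of `G` to which a new
vertex connects if it sees the finite graph `G` and uses the randomness `u ∈ [0, 1]`. -/
structure ConstructionFn where
  choose : FiniteDAG → I → Finset ℕ
  subset : ∀ G u, (choose G u : Set ℕ) ⊆ G.verts
  nonempty : ∀ G u, (choose G u).Nonempty

/-- The construction function that chooses all leaves. -/
def allLeaves : ConstructionFn where
  choose G _ := G.leaves
  subset G _ := G.leaves_subset
  nonempty G _ := G.leaves_nonempty

/-- `f` chooses a uniformly random set of `k` leaves, and all leaves if there are fewer than `k`: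
if `u` is uniform on `[0, 1]`, then `f.choose G u` is uniform over the sets of `min k L` leaves,
`L` being the number of leaves of `G`. -/
structure IsUniformLeafChoice (k : ℕ) (f : ConstructionFn) : Prop where
  mem : ∀ G u, f.choose G u ∈ G.leaves.powersetCard (min k G.leaves.card)
  measurableSet : ∀ G S, MeasurableSet {u : I | f.choose G u = S}
  uniform : ∀ G, ∀ S ∈ G.leaves.powersetCard (min k G.leaves.card),
    volume {u : I | f.choose G u = S} =
      ((G.leaves.card.choose (min k G.leaves.card) : ℕ) : ℝ≥0∞)⁻¹

/-- The asynchronous composition model started from the single root, together with the fact that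
the vertices at time `t` are `0, …, t`. Here `ξ t` and `θ t` are the delay and the randomness of
the vertex `t + 1`, which looks at the graph at time `(t + 1 - ξ t)₊` (truncated subtraction); the
minimum with `t` has no effect for delays that are at least `1`. -/
def acmAux (f : ConstructionFn) (ξ : ℕ → ℕ) (θ : ℕ → I) :
    (t : ℕ) → {G : FiniteDAG // G.verts = Set.Iic t}
  | 0 => ⟨FiniteDAG.single, by ext; simp [FiniteDAG.single]⟩
  | t + 1 =>
    let G := acmAux f ξ θ t
    let H := acmAux f ξ θ (min t (t + 1 - ξ t))
    ⟨G.1.attach (t + 1) (by rw [G.2]; simp) (f.choose H.1 (θ t)) (f.nonempty H.1 (θ t))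
      ((f.subset H.1 (θ t)).trans (by
        rw [G.2, H.2]; exact Set.Iic_subset_Iic.2 (min_le_left _ _))),
      by
        have h : insert (t + 1) G.1.verts = Set.Iic (t + 1) := by
          rw [G.2]; ext x; simp; omega
        exact h⟩
  termination_by t => t
  decreasing_by all_goals omega

/-- The graph `G_t(f)`. -/
def acm (f : ConstructionFn) (ξ : ℕ → ℕ) (θ : ℕ → I) (t : ℕ) : MarkedDAG :=
  (acmAux f ξ θ t).1.toMarkedDAG

instance : Nonempty MarkedDAG := ⟨FiniteDAG.single.toMarkedDAG⟩

/-- The asynchronous limit `G_∞(f)`, the limit of `G_t(f)` as `t → ∞` (an arbitrary graph if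
there is no limit). -/
def asyncLimit (f : ConstructionFn) (ξ : ℕ → ℕ) (θ : ℕ → I) : MarkedDAG :=
  limUnder atTop fun t => acm f ξ θ t

/-- `ξ` is an i.i.d. sequence of delays with law `ν`, `θ` is an i.i.d. sequence of uniform
variables on `[0, 1]`, and the two sequences are independent. -/
structure IsDriving {Ω : Type*} [MeasurableSpace Ω] (μ : Measure Ω) (ν : Measure ℕ)
    (ξ : Ω → ℕ → ℕ) (θ : Ω → ℕ → I) : Prop where
  measurable_delay : ∀ t, Measurable fun ω => ξ ω t
  measurable_theta : ∀ t, Measurable fun ω => θ ω t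
  law_delay : ∀ t, μ.map (fun ω => ξ ω t) = ν
  law_theta : ∀ t, μ.map (fun ω => θ ω t) = volume
  iIndep_delay : iIndepFun (fun t ω => ξ ω t) μ
  iIndep_theta : iIndepFun (fun t ω => θ ω t) μ
  indep : IndepFun ξ θ μ


/-- Construction functions that choose uniformly random sets of `k` leaves exist. -/
theorem exists_isUniformLeafChoice (k : ℕ+) : ∃ f, IsUniformLeafChoice k f := by
  have key : ∀ P : Finset (Finset ℕ), P.Nonempty → ∃ g : I → Finset ℕ, (∀ u, g u ∈ P) ∧
      (∀ S, MeasurableSet {u | g u = S}) ∧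
      ∀ S ∈ P, volume {u | g u = S} = (P.card : ℝ≥0∞)⁻¹ := by
    intro P hP
    let mP : MeasurableSpace P := ⊤
    have : DiscreteMeasurableSpace P := ⟨fun _ => trivial⟩
    have : Nonempty P := hP.to_subtype
    obtain ⟨g, hg, hmap⟩ := Measure.exists_measurable_map_eq
      (PMF.uniformOfFintype P).toMeasure
    refine ⟨fun u => g u, fun u => (g u).2, fun S => ?_, fun S hS => ?_⟩
    · exact hg (t := {x : P | (x : Finset ℕ) = S}) (MeasurableSet.of_discrete)
    · have h : {u | ((g u : P) : Finset ℕ) = S} = g ⁻¹' {⟨S, hS⟩} := by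
        ext u; simp [Subtype.ext_iff]
      rw [h, ← Measure.map_apply hg (MeasurableSet.of_discrete), hmap,
        PMF.toMeasure_apply_singleton _ _ (MeasurableSet.of_discrete)]
      simp
  choose g hg1 hg2 hg3 using fun G : FiniteDAG =>
    key (G.leaves.powersetCard (min k G.leaves.card))
      (Finset.powersetCard_nonempty.2 (min_le_right _ _))
  refine ⟨⟨g, fun G u => ?_, fun G u => ?_⟩, hg1, hg2, fun G S hS => ?_⟩
  · exact (Finset.coe_subset.2 (Finset.mem_powersetCard.1 (hg1 G u)).1).trans G.leaves_subset
  · rw [← Finset.card_pos, (Finset.mem_powersetCard.1 (hg1 G u)).2]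
    exact lt_min k.pos G.leaves_nonempty.card_pos
  · simpa using hg3 G S hS

end

/-! The argument is pathwise. A vertex picks its targets once and edges are never removed, so the
graphs `G_t(f)` are truncations of a single relation `Edge`. All that is needed of the delays is
that `seenTime` tends to infinity, which holds almost surely by Borel–Cantelli, since they have
finite mean (`IsDriving.ae_tendsto_seenTime`).

When only leaves are chosen, a vertex with an in-edge is ignored by everyone who sees that edge,
hence by all but finitely many vertices. So the union of the `G_t(f)` is locally finite, and it is
the limit (`tendsto_acm_limitDAG`).

As `G_t` has at most `t + 1` leaves, `f_k` and `f_∞` build the same graph up to time `k`, whatever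
`θ` is (`IsUniformLeafChoice.acmAux_eq`). Under `f_∞` every vertex eventually gets an in-edge, so a
finite ball receives no edges after some finite time; once `k` exceeds that time, the same is true
under `f_k` (`tendsto_asyncLimit_allLeaves`).

The law of the driving sequences does not depend on `k`. Convergence in distribution can therefore
be checked with one common pair of sequences, where it follows from almost sure convergence
(`tendstoInDistribution_comp_of_map_eq`). -/

noncomputable section

/-! ### Criteria for local convergence -/

namespace MarkedDAG

theorem dist_le_of_ballsAgree {s : ℕ} {G H : MarkedDAG} (h : BallsAgree s G H) :
    dist G H ≤ 1 / ((s : ℝ) + 1) := by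
  have h1 : (s : ℕ∞) ≤ agreeRadius G H := le_iSup₂_of_le s h le_rfl
  have h2 : (1 + (agreeRadius G H : ℝ≥0∞))⁻¹ ≤ (1 + (s : ℝ≥0∞))⁻¹ := by
    refine ENNReal.inv_le_inv.2 (add_le_add_right ?_ 1)
    exact_mod_cast ENat.toENNReal_le.2 h1
  have h3 := ENNReal.toReal_mono (by simp) h2
  refine h3.trans_eq ?_
  rw [ENNReal.toReal_inv, ENNReal.toReal_add (by simp) (by simp), one_div, add_comm]
  simp

/-- Graphs converge if, for every radius, their balls eventually agree with those of the limit. -/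
theorem tendsto_of_eventually_ballsAgree {ι : Type*} {l : Filter ι} {G : ι → MarkedDAG}
    {H : MarkedDAG} (h : ∀ s, ∀ᶠ i in l, BallsAgree s (G i) H) : Tendsto G l (𝓝 H) := by
  rw [Metric.tendsto_nhds]
  intro ε hε
  obtain ⟨s, hs⟩ := exists_nat_one_div_lt hε
  filter_upwards [h s] with i hi
  exact (dist_le_of_ballsAgree hi).trans_lt hs

/-- If two graphs have the same root, and the same marks and edges at all vertices of the ball of
radius `s` of one of them, then their balls of radius `s` agree. -/
theorem ballsAgree_of_eqOn {s : ℕ} {G H : MarkedDAG} (hr : G.root = H.root)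
    (hm : ∀ v ∈ H.ball s, G.mark v = H.mark v)
    (ha : ∀ u ∈ H.ball s, ∀ v, (G.Adj u v ↔ H.Adj u v) ∧ (G.Adj v u ↔ H.Adj v u)) :
    BallsAgree s G H := by
  -- The balls are equal as sets, so the identity serves as isomorphism: passing from radius `r` to
  -- `r + 1` only uses edges at vertices of the smaller ball.
  have hb : ∀ r ≤ s, G.ball r = H.ball r := by
    intro r
    induction r with
    | zero =>
      intro _
      ext v
      simp [ball, hr]
    | succ r ih =>
      intro hrs
      ext v
      rw [mem_ball_succ, mem_ball_succ, ih (by omega)]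
      refine or_congr_right (exists_congr fun u => and_congr_right fun hu => ?_)
      have := ha u (H.ball_mono (by omega) hu) v
      rw [skeleton_adj, skeleton_adj, this.1, this.2]
  have hs := hb s le_rfl
  refine ⟨id, by rw [hs]; exact Set.bijOn_id _, hr, ?_, ?_⟩
  · intro u hu v _
    exact (ha u (hs ▸ hu) v).1
  · intro v hv
    exact hm v (hs ▸ hv)

theorem finite_ball (G : MarkedDAG) (s : ℕ) : (G.ball s).Finite := by
  induction s with
  | zero =>
    refine (Set.finite_singleton G.root).subset fun v hv => ?_
    simpa [ball] using hv
  | succ s ih =>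
    refine (ih.union (ih.biUnion fun u _ => G.locallyFinite u)).subset fun v hv => ?_
    rcases (G.mem_ball_succ s v).1 hv with hv | ⟨u, hu, huv⟩
    · exact Or.inl hv
    · exact Or.inr (Set.mem_biUnion hu (G.skeleton_adj.1 huv))

end MarkedDAG

/-! ### The model as a growing edge relation -/

theorem FiniteDAG.attach_congr {G G' : FiniteDAG} {n : ℕ} {hn : n ∉ G.verts} {hn' : n ∉ G'.verts}
    {S S' : Finset ℕ} {hS : S.Nonempty} {hS' : S'.Nonempty} {hSG : (S : Set ℕ) ⊆ G.verts}
    {hSG' : (S' : Set ℕ) ⊆ G'.verts} (h : G = G') (hSS : S = S') :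
    G.attach n hn S hS hSG = G'.attach n hn' S' hS' hSG' := by
  subst h hSS
  rfl

/-- The time of the graph that is seen by the vertex `n + 1`. -/
def seenTime (ξ : ℕ → ℕ) (n : ℕ) : ℕ := min n (n + 1 - ξ n)

/-- The set of vertices to which the vertex `n + 1` connects. -/
def parents (f : ConstructionFn) (ξ : ℕ → ℕ) (θ : ℕ → I) (n : ℕ) : Finset ℕ :=
  f.choose (acmAux f ξ θ (seenTime ξ n)).1 (θ n)

/-- The edges of all the graphs `G_t(f)` together. -/
def Edge (f : ConstructionFn) (ξ : ℕ → ℕ) (θ : ℕ → I) (u v : ℕ) : Prop :=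
  ∃ n, u = n + 1 ∧ v ∈ parents f ξ θ n

section

variable {f : ConstructionFn} {ξ : ℕ → ℕ} {θ : ℕ → I}

/-- Unfolds one step of the recursion; quantifying over the proof arguments of `attach` keeps them
out of later rewriting. -/
theorem acmAux_succ (f : ConstructionFn) (ξ : ℕ → ℕ) (θ : ℕ → I) (t : ℕ) :
    ∃ hn hS hSG, (acmAux f ξ θ (t + 1)).1 =
      (acmAux f ξ θ t).1.attach (t + 1) hn (parents f ξ θ t) hS hSG := by
  refine ⟨by simp [(acmAux f ξ θ t).2], f.nonempty _ _, (f.subset _ _).trans ?_,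
    congrArg Subtype.val (acmAux.eq_2 f ξ θ t)⟩
  rw [(acmAux f ξ θ t).2, (acmAux f ξ θ (seenTime ξ t)).2]
  exact Set.Iic_subset_Iic.2 (min_le_left _ _)

theorem le_of_mem_parents {n v : ℕ} (h : v ∈ parents f ξ θ n) : v ≤ seenTime ξ n := by
  have h' := f.subset _ _ h
  rw [(acmAux f ξ θ (seenTime ξ n)).2] at h'
  exact h'

theorem Edge.lt {u v : ℕ} (h : Edge f ξ θ u v) : v < u := by
  obtain ⟨n, rfl, hv⟩ := h
  exact Nat.lt_succ_of_le ((le_of_mem_parents hv).trans (min_le_left _ _))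

/-- Vertex `u` fixes its out-edges at time `u` for good. Time thus enters only through the bound on
the source, and questions about limits become questions about `Edge`. -/
theorem acm_adj (f : ConstructionFn) (ξ : ℕ → ℕ) (θ : ℕ → I) (t u v : ℕ) :
    (acm f ξ θ t).Adj u v ↔ u ≤ t ∧ Edge f ξ θ u v := by
  induction t with
  | zero =>
    have h : (acmAux f ξ θ 0).1 = FiniteDAG.single := congrArg Subtype.val (acmAux.eq_1 f ξ θ)
    simp only [acm, h, FiniteDAG.single, false_iff]
    rintro ⟨hu, he⟩
    have := he.lt
    omega
  | succ t ih =>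
    obtain ⟨_, _, _, h⟩ := acmAux_succ f ξ θ t
    have h' : (acm f ξ θ (t + 1)).Adj u v ↔
        (acm f ξ θ t).Adj u v ∨ (u = t + 1 ∧ v ∈ parents f ξ θ t) := by
      simp only [acm, h, FiniteDAG.attach]
    rw [h', ih]
    constructor
    · rintro (⟨hu, he⟩ | ⟨rfl, hv⟩)
      · exact ⟨by omega, he⟩
      · exact ⟨le_rfl, t, rfl, hv⟩
    · rintro ⟨hu, n, rfl, hv⟩
      rcases Nat.lt_or_ge n t with hn | hn
      · exact Or.inl ⟨hn, n, rfl, hv⟩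
      · obtain rfl : n = t := by omega
        exact Or.inr ⟨rfl, hv⟩

theorem acm_root (f : ConstructionFn) (ξ : ℕ → ℕ) (θ : ℕ → I) (t : ℕ) :
    (acm f ξ θ t).root = 0 := by
  induction t with
  | zero =>
    have h : (acmAux f ξ θ 0).1 = FiniteDAG.single := congrArg Subtype.val (acmAux.eq_1 f ξ θ)
    simp only [acm, h, FiniteDAG.single]
  | succ t ih =>
    obtain ⟨_, _, _, h⟩ := acmAux_succ f ξ θ t
    simpa only [acm, h, FiniteDAG.attach] using ih

theorem acm_mark (f : ConstructionFn) (ξ : ℕ → ℕ) (θ : ℕ → I) (t : ℕ) {v : ℕ} (hv : v ≤ t) :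
    (acm f ξ θ t).mark v = v := by
  induction t with
  | zero =>
    have h : (acmAux f ξ θ 0).1 = FiniteDAG.single := congrArg Subtype.val (acmAux.eq_1 f ξ θ)
    simp only [acm, h, FiniteDAG.single]
    omega
  | succ t ih =>
    obtain ⟨_, _, _, h⟩ := acmAux_succ f ξ θ t
    simp only [acm, h, FiniteDAG.attach]
    rcases eq_or_ne v (t + 1) with rfl | hne
    · simp
    · rw [Function.update_of_ne hne]
      exact ih (by omega)

/-- The graph at time `t` is a function of the sets chosen by the vertices `1, …, t`. -/
theorem acmAux_congr {f' : ConstructionFn} {ξ' : ℕ → ℕ} {θ' : ℕ → I} {t : ℕ}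
    (h : ∀ n < t, parents f ξ θ n = parents f' ξ' θ' n) :
    (acmAux f ξ θ t).1 = (acmAux f' ξ' θ' t).1 := by
  induction t with
  | zero => rw [acmAux.eq_1, acmAux.eq_1]
  | succ t ih =>
    obtain ⟨_, _, _, h1⟩ := acmAux_succ f ξ θ t
    obtain ⟨_, _, _, h2⟩ := acmAux_succ f' ξ' θ' t
    rw [h1, h2]
    exact FiniteDAG.attach_congr (ih fun n hn => h n (by omega)) (h t (by omega))

theorem mem_leaves_acmAux {t v : ℕ} :
    v ∈ (acmAux f ξ θ t).1.leaves ↔ v ≤ t ∧ ∀ w ≤ t, ¬ Edge f ξ θ w v := by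
  have h1 : ∀ w, (acmAux f ξ θ t).1.Adj w v ↔ w ≤ t ∧ Edge f ξ θ w v :=
    fun w => acm_adj f ξ θ t w v
  simp only [FiniteDAG.leaves, Finset.mem_filter, Set.Finite.mem_toFinset, h1,
    (acmAux f ξ θ t).2, Set.mem_Iic, not_and]

theorem card_leaves_acmAux_le (f : ConstructionFn) (ξ : ℕ → ℕ) (θ : ℕ → I) (t : ℕ) :
    (acmAux f ξ θ t).1.leaves.card ≤ t + 1 := by
  have h : (acmAux f ξ θ t).1.leaves ⊆ Finset.range (t + 1) := by
    intro v hv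
    rw [mem_leaves_acmAux] at hv
    simpa [Nat.lt_succ_iff] using hv.1
  simpa using Finset.card_le_card h

end

/-- `f` chooses leaves only. -/
def ChoosesLeaves (f : ConstructionFn) : Prop := ∀ G u, f.choose G u ⊆ G.leaves

theorem choosesLeaves_allLeaves : ChoosesLeaves allLeaves := fun _ _ => subset_rfl

theorem IsUniformLeafChoice.choosesLeaves {k : ℕ} {f : ConstructionFn}
    (hf : IsUniformLeafChoice k f) : ChoosesLeaves f :=
  fun G u => (Finset.mem_powersetCard.1 (hf.mem G u)).1

theorem IsUniformLeafChoice.choose_eq_leaves {k : ℕ} {f : ConstructionFn}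
    (hf : IsUniformLeafChoice k f) {G : FiniteDAG} (hG : G.leaves.card ≤ k) (u : I) :
    f.choose G u = G.leaves := by
  obtain ⟨h1, h2⟩ := Finset.mem_powersetCard.1 (hf.mem G u)
  exact Finset.eq_of_subset_of_card_le h1 (by rw [h2, min_eq_right hG])

/-! ### Existence of the limit and agreement up to time `k` -/

section Limit

variable {f : ConstructionFn} {ξ : ℕ → ℕ} {θ : ℕ → I}

/-- A vertex that sees a graph in which `v` already has an in-edge does not connect to `v`. -/
theorem ChoosesLeaves.not_edge (hf : ChoosesLeaves f) {n v w : ℕ} (hw : w ≤ seenTime ξ n)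
    (he : Edge f ξ θ w v) : ¬ Edge f ξ θ (n + 1) v := by
  rintro ⟨m, hm, hv⟩
  obtain rfl : n = m := by omega
  exact (mem_leaves_acmAux.1 (hf _ _ hv)).2 w hw he

/-- After a first in-edge from `w`, only vertices that see a graph older than `w` can still connect
to `v`, and there are finitely many of these. -/
theorem ChoosesLeaves.finite_inEdges (hf : ChoosesLeaves f)
    (hξ : Tendsto (seenTime ξ) atTop atTop) (v : ℕ) : {w | Edge f ξ θ w v}.Finite := by
  by_cases h : ∃ w, Edge f ξ θ w v
  · obtain ⟨w, hw⟩ := h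
    obtain ⟨N, hN⟩ := eventually_atTop.1 (hξ.eventually_ge_atTop w)
    refine (Set.finite_Iic N).subset fun u hu => ?_
    by_contra hlt
    obtain ⟨n, rfl, _⟩ := id hu
    exact hf.not_edge (hN n (by simp at hlt; omega)) hw hu
  · convert Set.finite_empty
    ext w
    simpa using fun hw => h ⟨w, hw⟩

/-- The graph with all the edges of the graphs `G_t(f)`. -/
def limitDAG (f : ConstructionFn) (ξ : ℕ → ℕ) (θ : ℕ → I)
    (h : ∀ v, {w | Edge f ξ θ w v}.Finite) : MarkedDAG where
  verts := Set.univ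
  Adj := Edge f ξ θ
  root := 0
  mark v := v
  adj_mem _ _ _ := ⟨trivial, trivial⟩
  root_mem := trivial
  acyclic v hv := by
    have key : ∀ a b, Relation.TransGen (Edge f ξ θ) a b → b < a := by
      intro a b hab
      induction hab with
      | single h => exact h.lt
      | tail _ h ih => exact h.lt.trans ih
    exact lt_irrefl _ (key v v hv)
  connected v _ := by
    induction v using Nat.strong_induction_on with
    | _ v ih =>
      rcases v with _ | n
      · exact SimpleGraph.Reachable.refl _
      · obtain ⟨w, hw⟩ := f.nonempty (acmAux f ξ θ (seenTime ξ n)).1 (θ n)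
        have he : Edge f ξ θ (n + 1) w := ⟨n, rfl, hw⟩
        refine (ih w he.lt trivial).trans (SimpleGraph.Adj.reachable ?_)
        rw [SimpleGraph.fromRel_adj]
        exact ⟨he.lt.ne, Or.inr he⟩
  locallyFinite v :=
    ((Set.finite_Iio v).union (h v)).subset fun _ hw => hw.imp Edge.lt id

theorem tendsto_acm_limitDAG (h : ∀ v, {w | Edge f ξ θ w v}.Finite) :
    Tendsto (acm f ξ θ) atTop (𝓝 (limitDAG f ξ θ h)) := by
  refine MarkedDAG.tendsto_of_eventually_ballsAgree fun s => ?_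
  -- Radius `s + 1`, because an edge into the ball of radius `s` may start one step outside it, and
  -- its source must be present at time `t`.
  obtain ⟨T, hT⟩ := ((limitDAG f ξ θ h).finite_ball (s + 1)).bddAbove
  filter_upwards [eventually_ge_atTop T] with t ht
  have hle : ∀ v ∈ (limitDAG f ξ θ h).ball (s + 1), v ≤ t := fun v hv => (hT hv).trans ht
  have hmono := (limitDAG f ξ θ h).ball_mono (Nat.le_succ s)
  refine MarkedDAG.ballsAgree_of_eqOn (acm_root f ξ θ t)
    (fun v hv => acm_mark f ξ θ t (hle v (hmono hv))) fun u hu v => ⟨?_, ?_⟩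
  · rw [acm_adj]
    exact and_iff_right (hle u (hmono hu))
  · rw [acm_adj]
    refine and_iff_right_of_imp fun hvu => hle v ?_
    rw [MarkedDAG.mem_ball_succ]
    exact Or.inr ⟨u, hu, (MarkedDAG.skeleton_adj _).2 (Or.inr hvu)⟩

theorem ChoosesLeaves.tendsto_asyncLimit (hf : ChoosesLeaves f)
    (hξ : Tendsto (seenTime ξ) atTop atTop) :
    Tendsto (acm f ξ θ) atTop (𝓝 (asyncLimit f ξ θ)) :=
  tendsto_nhds_limUnder ⟨_, tendsto_acm_limitDAG (hf.finite_inEdges hξ)⟩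

/-- In a pseudometric space `limUnder` selects some limit, so `asyncLimit` is the explicit graph
only up to distance zero. -/
theorem ChoosesLeaves.inseparable_limitDAG (hf : ChoosesLeaves f)
    (hξ : Tendsto (seenTime ξ) atTop atTop) :
    Inseparable (asyncLimit f ξ θ) (limitDAG f ξ θ (hf.finite_inEdges hξ)) :=
  tendsto_nhds_unique_inseparable (hf.tendsto_asyncLimit hξ) (tendsto_acm_limitDAG _)

/-- As long as there are at most `k` leaves, choosing `k` leaves means choosing all of them. -/
theorem IsUniformLeafChoice.acmAux_eq {k : ℕ} (hf : IsUniformLeafChoice k f) (θ' : ℕ → I)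
    {t : ℕ} (ht : t ≤ k) : (acmAux f ξ θ t).1 = (acmAux allLeaves ξ θ' t).1 := by
  induction t using Nat.strong_induction_on with
  | _ t ih =>
    refine acmAux_congr fun n hn => ?_
    have hle : seenTime ξ n ≤ n := min_le_left _ _
    have h := ih (seenTime ξ n) (by omega) (by omega)
    rw [parents, hf.choose_eq_leaves, h]
    · rfl
    -- The seen graph has at most `seenTime ξ n + 1 ≤ n + 1 ≤ t ≤ k` leaves.
    · exact (card_leaves_acmAux_le f ξ θ _).trans (by omega)

theorem IsUniformLeafChoice.edge_iff {k : ℕ} (hf : IsUniformLeafChoice k f) (θ' : ℕ → I)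
    {u v : ℕ} (hu : u ≤ k) : Edge f ξ θ u v ↔ Edge allLeaves ξ θ' u v := by
  have h : acm f ξ θ u = acm allLeaves ξ θ' u :=
    congrArg FiniteDAG.toMarkedDAG (hf.acmAux_eq θ' hu)
  have h1 := acm_adj f ξ θ u u v
  rw [h, acm_adj] at h1
  simpa using h1.symm

/-- A vertex without in-edges would stay a leaf forever, and any vertex that sees it as a leaf
connects to it. -/
theorem exists_edge_allLeaves (hξ : Tendsto (seenTime ξ) atTop atTop) (v : ℕ) :
    ∃ w, Edge allLeaves ξ θ w v := by
  by_contra! hno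
  obtain ⟨n, hn⟩ := (hξ.eventually_ge_atTop v).exists
  exact hno (n + 1) ⟨n, rfl, mem_leaves_acmAux.2 ⟨hn, fun w _ => hno w⟩⟩

end Limit

/-! ### Pathwise convergence as `k → ∞` -/

section ManyLeaves

variable {f : ℕ+ → ConstructionFn} {ξ : ℕ → ℕ}

theorem eventually_le_pnat (N : ℕ) : ∀ᶠ k : ℕ+ in atTop, N ≤ k := by
  filter_upwards [eventually_ge_atTop (N.succPNat)] with k hk
  have : (N.succPNat : ℕ) ≤ k := hk
  simp at this
  omega

theorem tendsto_acm_allLeaves (hf : ∀ k : ℕ+, IsUniformLeafChoice k (f k))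
    (θ : ℕ+ → ℕ → I) (θ' : ℕ → I) (t : ℕ) :
    Tendsto (fun k => acm (f k) ξ (θ k) t) atTop (𝓝 (acm allLeaves ξ θ' t)) := by
  refine tendsto_const_nhds.congr' ?_
  filter_upwards [eventually_le_pnat t] with k hk
  exact congrArg FiniteDAG.toMarkedDAG ((hf k).acmAux_eq θ' hk).symm

/-- If the delays are such that the seen times tend to infinity, then the asynchronous limits
converge for any choice of the randomness of the construction functions. Every vertex of a given
ball of the limit for `allLeaves` gets an in-edge up to some time, which every late vertex sees;
for `k` large, the graphs agree until then. -/
theorem tendsto_asyncLimit_allLeaves (hf : ∀ k : ℕ+, IsUniformLeafChoice k (f k))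
    (hξ : Tendsto (seenTime ξ) atTop atTop) (θ : ℕ+ → ℕ → I) (θ' : ℕ → I) :
    Tendsto (fun k => asyncLimit (f k) ξ (θ k)) atTop (𝓝 (asyncLimit allLeaves ξ θ')) := by
  have hfin := fun k => (hf k).choosesLeaves.finite_inEdges (θ := θ k) hξ
  have hfin' := choosesLeaves_allLeaves.finite_inEdges (θ := θ') hξ
  have hlim : Tendsto (fun k => limitDAG (f k) ξ (θ k) (hfin k)) atTop
      (𝓝 (limitDAG allLeaves ξ θ' hfin')) := by
    refine MarkedDAG.tendsto_of_eventually_ballsAgree fun s => ?_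
    obtain ⟨T, hT⟩ := ((limitDAG allLeaves ξ θ' hfin').finite_ball s).bddAbove
    choose w hw using exists_edge_allLeaves (θ := θ') hξ
    obtain ⟨T₁, hT₁⟩ := ((Set.finite_Iic T).image w).bddAbove
    obtain ⟨T₂, hT₂⟩ := eventually_atTop.1 (hξ.eventually_ge_atTop T₁)
    -- Beyond `T` the out-edges of the ball agree, beyond `T₁` so do the blocking edges `w v → v`,
    -- and beyond `T₂` every new vertex sees the latter.
    filter_upwards [eventually_le_pnat (max T (max T₁ (T₂ + 1)))] with k hk
    have hkey : ∀ u v, v ≤ T → (Edge (f k) ξ (θ k) u v ↔ Edge allLeaves ξ θ' u v) := by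
      intro u v hv
      rcases le_or_gt u k with hu | hu
      · exact (hf k).edge_iff θ' hu
      · obtain ⟨n, rfl⟩ : ∃ n, u = n + 1 := ⟨u - 1, by omega⟩
        have hwv : w v ≤ T₁ := hT₁ ⟨v, hv, rfl⟩
        have hseen : w v ≤ seenTime ξ n := hwv.trans (hT₂ n (by omega))
        have hwk : Edge (f k) ξ (θ k) (w v) v := ((hf k).edge_iff θ' (by omega)).2 (hw v)
        exact iff_of_false ((hf k).choosesLeaves.not_edge hseen hwk)
          (choosesLeaves_allLeaves.not_edge hseen (hw v))
    refine MarkedDAG.ballsAgree_of_eqOn rfl (fun _ _ => rfl) fun u hu v => ⟨?_, ?_⟩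
    · exact (hf k).edge_iff θ' ((hT hu).trans (by omega))
    · exact hkey v u (hT hu)
  -- Both limits are at distance zero from their explicit graphs, so the two distances coincide.
  rw [tendsto_iff_dist_tendsto_zero] at hlim ⊢
  refine hlim.congr fun k => ?_
  have h1 := Metric.inseparable_iff.1 ((hf k).choosesLeaves.inseparable_limitDAG (θ := θ k) hξ)
  have h2 := Metric.inseparable_iff.1 (choosesLeaves_allLeaves.inseparable_limitDAG (θ := θ') hξ)
  have h3 := dist_triangle4 (asyncLimit (f k) ξ (θ k)) (limitDAG (f k) ξ (θ k) (hfin k))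
    (limitDAG allLeaves ξ θ' hfin') (asyncLimit allLeaves ξ θ')
  have h4 := dist_triangle4 (limitDAG (f k) ξ (θ k) (hfin k)) (asyncLimit (f k) ξ (θ k))
    (asyncLimit allLeaves ξ θ') (limitDAG allLeaves ξ θ' hfin')
  have h5 := dist_comm (asyncLimit (f k) ξ (θ k)) (limitDAG (f k) ξ (θ k) (hfin k))
  have h6 := dist_comm (asyncLimit allLeaves ξ θ') (limitDAG allLeaves ξ θ' hfin')
  linarith

end ManyLeaves

/-! ### Measurability in the driving sequences -/

section Measurability

/-- A set is measurable if it is so on each of countably many measurable pieces. -/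
theorem measurableSet_of_countable_pieces {Ω γ : Type*} [MeasurableSpace Ω] [Countable γ]
    {h : Ω → γ} (hh : ∀ c, MeasurableSet {ω | h ω = c}) {A : Set Ω}
    (hA : ∀ c, ∃ B, MeasurableSet B ∧ ∀ ω, h ω = c → (ω ∈ A ↔ ω ∈ B)) : MeasurableSet A := by
  choose B hB hAB using hA
  have : A = ⋃ c, {ω | h ω = c} ∩ B c := by
    ext ω
    simp only [Set.mem_iUnion, Set.mem_inter_iff, Set.mem_ofPred_eq, exists_eq_left']
    exact hAB _ ω rfl
  rw [this]
  exact MeasurableSet.iUnion fun c => (hh c).inter (hB c)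

variable {f : ConstructionFn}

theorem measurable_seenTime (n : ℕ) : Measurable fun ξ : ℕ → ℕ => seenTime ξ n :=
  (Measurable.of_discrete (f := fun m : ℕ => min n (n + 1 - m))).comp (measurable_pi_apply n)

/-- Fixing the seen time and the earlier parent sets, which take countably many values, fixes the
seen graph. On such a piece the choice depends on the coordinate `θ n` alone. -/
theorem measurableSet_parents_eq (hf : ∀ G S, MeasurableSet {u : I | f.choose G u = S})
    (n : ℕ) (S : Finset ℕ) :
    MeasurableSet {z : (ℕ → ℕ) × (ℕ → I) | parents f z.1 z.2 n = S} := by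
  induction n using Nat.strong_induction_on generalizing S with
  | _ n ih =>
    let h : (ℕ → ℕ) × (ℕ → I) → ℕ × (Fin n → Finset ℕ) :=
      fun z => (seenTime z.1 n, fun i => parents f z.1 z.2 i)
    refine measurableSet_of_countable_pieces (h := h) (fun c => ?_) fun c => ?_
    · have : {z | h z = c} = {z | seenTime z.1 n = c.1} ∩
          ⋂ i : Fin n, {z | parents f z.1 z.2 i = c.2 i} := by
        ext z
        simp [h, Prod.ext_iff, funext_iff]
      rw [this]
      exact ((measurable_seenTime n).comp measurable_fst (measurableSet_singleton c.1)).inter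
        (MeasurableSet.iInter fun i => ih i i.2 _)
    · by_cases hc : ∃ z, h z = c
      · obtain ⟨y, rfl⟩ := hc
        refine ⟨{z | f.choose (acmAux f y.1 y.2 (seenTime y.1 n)).1 (z.2 n) = S},
          ?_, fun z hz => ?_⟩
        · have hm : Measurable fun z : (ℕ → ℕ) × (ℕ → I) => z.2 n := by fun_prop
          exact measurableSet_preimage hm (hf (acmAux f y.1 y.2 (seenTime y.1 n)).1 S)
        obtain ⟨h1, h2⟩ := Prod.ext_iff.1 hz
        have h1' : seenTime z.1 n = seenTime y.1 n := h1
        have h3 : (acmAux f z.1 z.2 (seenTime y.1 n)).1 =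
            (acmAux f y.1 y.2 (seenTime y.1 n)).1 :=
          acmAux_congr fun i hi => congrFun h2 ⟨i, hi.trans_le (min_le_left _ _)⟩
        simp only [Set.mem_ofPred_eq, parents]
        rw [h1', h3]
      · exact ⟨∅, MeasurableSet.empty, fun z hz => (hc ⟨z, hz⟩).elim⟩

/-- The graph factors through countably many parent sets, so the preimage of any set of graphs is
measurable. -/
theorem measurable_acm (hf : ∀ G S, MeasurableSet {u : I | f.choose G u = S}) (t : ℕ) :
    Measurable fun z : (ℕ → ℕ) × (ℕ → I) => acm f z.1 z.2 t := by
  intro B _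
  let h : (ℕ → ℕ) × (ℕ → I) → (Fin t → Finset ℕ) := fun z i => parents f z.1 z.2 i
  refine measurableSet_of_countable_pieces (h := h) (fun c => ?_) fun c => ?_
  · have : {z | h z = c} = ⋂ i : Fin t, {z | parents f z.1 z.2 i = c i} := by
      ext z
      simp [h, funext_iff]
    rw [this]
    exact MeasurableSet.iInter fun i => measurableSet_parents_eq hf i _
  · by_cases hc : ∃ z, h z = c
    · obtain ⟨y, rfl⟩ := hc
      refine ⟨{_z | acm f y.1 y.2 t ∈ B}, MeasurableSet.const _, fun z hz => ?_⟩
      have h3 : acm f z.1 z.2 t = acm f y.1 y.2 t :=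
        congrArg FiniteDAG.toMarkedDAG (acmAux_congr fun i hi => congrFun hz ⟨i, hi⟩)
      simp only [Set.mem_preimage, Set.mem_ofPred_eq, h3]
    · exact ⟨∅, MeasurableSet.empty, fun z hz => (hc ⟨z, hz⟩).elim⟩

theorem measurableSet_choose_allLeaves (G : FiniteDAG) (S : Finset ℕ) :
    MeasurableSet {u : I | allLeaves.choose G u = S} :=
  MeasurableSet.const (G.leaves = S)

theorem ChoosesLeaves.aemeasurable_asyncLimit (hf : ChoosesLeaves f)
    (hfm : ∀ G S, MeasurableSet {u : I | f.choose G u = S})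
    {P : Measure ((ℕ → ℕ) × (ℕ → I))} (hP : ∀ᵐ z ∂P, Tendsto (seenTime z.1) atTop atTop) :
    AEMeasurable (fun z => asyncLimit f z.1 z.2) P := by
  refine aemeasurable_of_tendsto_metrizable_ae atTop
    (fun t => (measurable_acm hfm t).aemeasurable) ?_
  filter_upwards [hP] with z hz
  exact hf.tendsto_asyncLimit hz

end Measurability

/-! ### Laws of the driving sequences and seen times -/

section Driving

variable {Ω : Type*} [MeasurableSpace Ω] {μ : Measure Ω} {ν : Measure ℕ}
  {ξ : Ω → ℕ → ℕ} {θ : Ω → ℕ → I}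

theorem IsDriving.measurable (h : IsDriving μ ν ξ θ) : Measurable fun ω => (ξ ω, θ ω) :=
  (measurable_pi_lambda _ h.measurable_delay).prodMk (measurable_pi_lambda _ h.measurable_theta)

/-- The joint law of the driving sequences is determined by the law of the delays. -/
theorem IsDriving.map_eq [IsProbabilityMeasure μ] (h : IsDriving μ ν ξ θ) :
    μ.map (fun ω => (ξ ω, θ ω)) =
      (Measure.infinitePi fun _ : ℕ => ν).prod (Measure.infinitePi fun _ : ℕ => volume) := by
  have h1 := h.iIndep_delay.map_fun_eq_infinitePi_map h.measurable_delay
  have h2 := h.iIndep_theta.map_fun_eq_infinitePi_map h.measurable_theta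
  simp only [h.law_delay] at h1
  simp only [h.law_theta] at h2
  rw [(indepFun_iff_map_prod_eq_prod_map_map
    (measurable_pi_lambda _ h.measurable_delay).aemeasurable
    (measurable_pi_lambda _ h.measurable_theta).aemeasurable).1 h.indep, h1, h2]

/-- If the delays have finite mean, then almost surely the seen times tend to infinity. -/
theorem IsDriving.ae_tendsto_seenTime [IsProbabilityMeasure μ] (h : IsDriving μ ν ξ θ)
    (hν : Integrable (fun n : ℕ => (n : ℝ)) ν) :
    ∀ᵐ ω ∂μ, Tendsto (seenTime (ξ ω)) atTop atTop := by
  have : IsProbabilityMeasure ν := by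
    rw [← h.law_delay 0]
    exact Measure.isProbabilityMeasure_map (h.measurable_delay 0).aemeasurable
  -- The tail sum is controlled by the mean delay; this is the input to Borel–Cantelli.
  have hsum : ∑' j : ℕ, ν (Set.Ioi j) ≠ ∞ := by
    let _ : MeasureSpace ℕ := ⟨ν⟩
    have := tsum_prob_mem_Ioi_lt_top (X := fun n : ℕ => (n : ℝ)) hν (fun n => Nat.cast_nonneg n)
    have h' : ∀ j : ℕ, {n : ℕ | (n : ℝ) ∈ Set.Ioi (j : ℝ)} = Set.Ioi j := by
      intro j
      ext n
      simp
    simp only [h'] at this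
    exact this.ne
  -- If the vertex `j + m + 1` sees a time below `m`, then its delay exceeds `j`. The shift by `m`
  -- makes the probabilities `ν (Set.Ioi j)`, the same sum for every `m`.
  have hae : ∀ m : ℕ, ∀ᵐ ω ∂μ, ∀ᶠ j in atTop, ω ∉ {ω | ξ ω (j + m) ∈ Set.Ioi j} := by
    intro m
    refine ae_eventually_notMem ?_
    convert hsum using 4 with j
    rw [← h.law_delay (j + m), Measure.map_apply (h.measurable_delay _) measurableSet_Ioi]
    rfl
  filter_upwards [ae_all_iff.2 hae] with ω hω
  refine tendsto_atTop.2 fun m => ?_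
  obtain ⟨N, hN⟩ := eventually_atTop.1 (hω m)
  filter_upwards [eventually_ge_atTop (N + m)] with n hn
  have := hN (n - m) (by omega)
  simp only [Set.mem_Ioi, not_lt, Nat.sub_add_cancel (by omega : m ≤ n)] at this
  exact le_min (by omega) (by omega)

end Driving

/-- Random variables that are functions of identically distributed variables converge in
distribution if these functions converge almost everywhere. -/
theorem tendstoInDistribution_comp_of_map_eq {Ω S E ι : Type*} [MeasurableSpace Ω]
    [MeasurableSpace S] [TopologicalSpace E] [MeasurableSpace E] [OpensMeasurableSpace E]
    {l : Filter ι} [l.IsCountablyGenerated] {μ : Measure Ω} [IsProbabilityMeasure μ]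
    {P : Measure S} {Z : ι → Ω → S} {Z' : Ω → S} (hZ : ∀ i, Measurable (Z i))
    (hZ' : Measurable Z') (hlaw : ∀ i, μ.map (Z i) = P) (hlaw' : μ.map Z' = P)
    {F : ι → S → E} {F' : S → E} (hF : ∀ i, AEMeasurable (F i) P) (hF' : AEMeasurable F' P)
    (h : ∀ᵐ z ∂P, Tendsto (fun i => F i z) l (𝓝 (F' z))) :
    TendstoInDistribution (fun i ω => F i (Z i ω)) l (fun ω => F' (Z' ω)) (fun _ => μ) μ := by
  have : IsProbabilityMeasure P := hlaw' ▸ Measure.isProbabilityMeasure_map hZ'.aemeasurable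
  have hm : ∀ i, AEMeasurable (fun ω => F i (Z i ω)) μ := fun i =>
    AEMeasurable.comp_measurable (by rw [hlaw i]; exact hF i) (hZ i)
  have hm' : AEMeasurable (fun ω => F' (Z' ω)) μ :=
    AEMeasurable.comp_measurable (by rw [hlaw']; exact hF') hZ'
  refine ⟨hm, hm', ?_⟩
  -- Only laws matter, so the `Z i` are replaced by the identity on `S` under `P`, which realises
  -- all the `F i` on one space.
  have key := (tendstoInDistribution_of_ae_tendsto hF hF' h).tendsto
  have e : ∀ i, μ.map (fun ω => F i (Z i ω)) = P.map (F i) := fun i => by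
    rw [← hlaw i, AEMeasurable.map_map_of_aemeasurable (by rw [hlaw i]; exact hF i)
      (hZ i).aemeasurable]
    rfl
  have e' : μ.map (fun ω => F' (Z' ω)) = P.map F' := by
    rw [← hlaw', AEMeasurable.map_map_of_aemeasurable (by rw [hlaw']; exact hF')
      hZ'.aemeasurable]
    rfl
  simpa only [e, e'] using key

end

/-! ### The commuting diagram -/

theorem theorem2p6 {Ω : Type*} [MeasurableSpace Ω] (μ : Measure Ω) [IsProbabilityMeasure μ]
    (ν : Measure ℕ) (hν_pos : ν {0} = 0) (hν_mean : Integrable (fun n : ℕ => (n : ℝ)) ν)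
    (f : ℕ+ → ConstructionFn) (hf : ∀ k : ℕ+, IsUniformLeafChoice k (f k))
    (ξ : ℕ+ → Ω → ℕ → ℕ) (θ : ℕ+ → Ω → ℕ → I)
    (hdrive : ∀ k, IsDriving μ ν (ξ k) (θ k))
    (ξ' : Ω → ℕ → ℕ) (θ' : Ω → ℕ → I) (hdrive' : IsDriving μ ν ξ' θ') :
    -- the limits as `t → ∞` exist almost surely
    ((∀ k, ∀ᵐ ω ∂μ, ∃ H, Tendsto (fun t => acm (f k) (ξ k ω) (θ k ω) t) atTop (𝓝 H)) ∧
      (∀ᵐ ω ∂μ, ∃ H, Tendsto (fun t => acm allLeaves (ξ' ω) (θ' ω) t) atTop (𝓝 H))) ∧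
    -- the four convergences in distribution
    ((∀ t, TendstoInDistribution (fun k ω => acm (f k) (ξ k ω) (θ k ω) t) atTop
        (fun ω => acm allLeaves (ξ' ω) (θ' ω) t) (fun _ => μ) μ) ∧
      (∀ k, TendstoInDistribution (fun t ω => acm (f k) (ξ k ω) (θ k ω) t) atTop
        (fun ω => asyncLimit (f k) (ξ k ω) (θ k ω)) (fun _ => μ) μ) ∧
      TendstoInDistribution (fun t ω => acm allLeaves (ξ' ω) (θ' ω) t) atTop
        (fun ω => asyncLimit allLeaves (ξ' ω) (θ' ω)) (fun _ => μ) μ ∧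
      TendstoInDistribution (fun k ω => asyncLimit (f k) (ξ k ω) (θ k ω)) atTop
        (fun ω => asyncLimit allLeaves (ξ' ω) (θ' ω)) (fun _ => μ) μ) ∧
    -- the four almost sure convergences, if all graphs are built with the same delays
    ((∃ δ : ℝ, 0 < δ ∧ Integrable (fun n : ℕ => (n : ℝ) ^ (1 + δ)) ν) →
      (∀ k, ∀ᵐ ω ∂μ, ξ k ω = ξ' ω) →
      ∀ᵐ ω ∂μ,
        (∀ t, Tendsto (fun k => acm (f k) (ξ k ω) (θ k ω) t) atTop
          (𝓝 (acm allLeaves (ξ' ω) (θ' ω) t))) ∧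
        (∀ k, Tendsto (fun t => acm (f k) (ξ k ω) (θ k ω) t) atTop
          (𝓝 (asyncLimit (f k) (ξ k ω) (θ k ω)))) ∧
        Tendsto (fun t => acm allLeaves (ξ' ω) (θ' ω) t) atTop
          (𝓝 (asyncLimit allLeaves (ξ' ω) (θ' ω))) ∧
        Tendsto (fun k => asyncLimit (f k) (ξ k ω) (θ k ω)) atTop
          (𝓝 (asyncLimit allLeaves (ξ' ω) (θ' ω)))) := by
  let P : Measure ((ℕ → ℕ) × (ℕ → I)) :=
    (Measure.infinitePi fun _ : ℕ => ν).prod (Measure.infinitePi fun _ : ℕ => volume)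
  have hgood := fun k => (hdrive k).ae_tendsto_seenTime hν_mean
  have hgood' := hdrive'.ae_tendsto_seenTime hν_mean
  have hmeas := fun k => (hdrive k).measurable
  have hlaw : ∀ k, μ.map (fun ω => (ξ k ω, θ k ω)) = P := fun k => (hdrive k).map_eq
  have hlaw' : μ.map (fun ω => (ξ' ω, θ' ω)) = P := hdrive'.map_eq
  have hgoodP : ∀ᵐ z ∂P, Tendsto (seenTime z.1) atTop atTop := by
    rw [← hlaw', ae_map_iff hdrive'.measurable.aemeasurable]
    · exact hgood'
    -- Transferring the almost sure event to `P` needs its measurability, seen from countable unions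
    -- and intersections.
    · simp only [tendsto_atTop, eventually_atTop, Set.ofPred_forall, Set.ofPred_exists]
      exact MeasurableSet.iInter fun m => MeasurableSet.iUnion fun N =>
        MeasurableSet.iInter fun n => MeasurableSet.iInter fun _ =>
          ((measurable_seenTime n).comp measurable_fst) measurableSet_Ici
  have hacm := fun k t => (measurable_acm (hf k).measurableSet t).aemeasurable (μ := P)
  have hacm' := fun t =>
    (measurable_acm measurableSet_choose_allLeaves t).aemeasurable (μ := P)
  have hasync := fun k => (hf k).choosesLeaves.aemeasurable_asyncLimit (hf k).measurableSet hgoodP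
  have hasync' :=
    choosesLeaves_allLeaves.aemeasurable_asyncLimit measurableSet_choose_allLeaves hgoodP
  refine ⟨⟨fun k => ?_, ?_⟩, ⟨fun t => ?_, fun k => ?_, ?_, ?_⟩, ?_⟩
  · filter_upwards [hgood k] with ω hω
    exact ⟨_, (hf k).choosesLeaves.tendsto_asyncLimit hω⟩
  · filter_upwards [hgood'] with ω hω
    exact ⟨_, choosesLeaves_allLeaves.tendsto_asyncLimit hω⟩
  · exact tendstoInDistribution_comp_of_map_eq hmeas hdrive'.measurable hlaw hlaw'
      (F := fun k z => acm (f k) z.1 z.2 t) (fun k => hacm k t) (hacm' t)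
      (ae_of_all _ fun z => tendsto_acm_allLeaves hf (fun _ => z.2) z.2 t)
  · exact tendstoInDistribution_comp_of_map_eq (fun _ => hmeas k) (hmeas k) (fun _ => hlaw k)
      (hlaw k) (F := fun t z => acm (f k) z.1 z.2 t) (hacm k) (hasync k)
      (hgoodP.mono fun z hz => (hf k).choosesLeaves.tendsto_asyncLimit hz)
  · exact tendstoInDistribution_comp_of_map_eq (fun _ => hdrive'.measurable) hdrive'.measurable
      (fun _ => hlaw') hlaw' (F := fun t z => acm allLeaves z.1 z.2 t) hacm' hasync'
      (hgoodP.mono fun z hz => choosesLeaves_allLeaves.tendsto_asyncLimit hz)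
  · exact tendstoInDistribution_comp_of_map_eq hmeas hdrive'.measurable hlaw hlaw'
      (F := fun k z => asyncLimit (f k) z.1 z.2) hasync hasync'
      -- On the canonical space all `k` share the delays `z.1`, so the pathwise statement applies.
      (hgoodP.mono fun z hz => tendsto_asyncLimit_allLeaves hf hz (fun _ => z.2) z.2)
  · -- the higher moment is not needed: convergence holds wherever the seen times tend to infinity
    intro _ hcouple
    filter_upwards [hgood', ae_all_iff.2 hcouple] with ω hω hξ
    simp only [hξ]
    exact ⟨fun t => tendsto_acm_allLeaves hf _ _ t,
      fun k => (hf k).choosesLeaves.tendsto_asyncLimit hω,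
      choosesLeaves_allLeaves.tendsto_asyncLimit hω,
      tendsto_asyncLimit_allLeaves hf hω _ _⟩
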